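/- Let $\mathfrak g$ be a finite dimensional real Lie algebra, $M$ a (Hausdorff, finite dimensional) smooth manifold, and $\zeta:\mathfrak g\to\mathfrak X(M)$, $X\mapsto\zeta_X$, a Lie algebra homomorphism into the Lie algebra of smooth vector fields. *Notation.* A $\mathfrak g$-valued or $TM$-valued form is *horizontal* if it vanishes whenever one of its arguments is a value of some $\zeta_X$, $X\in\mathfrak g$. A form $\varphi\in\Omega^p(M;\mathfrak g)$ is *$\mathfrak g$-equivariant* if $\mathcal L_{\zeta_X}\varphi=-\operatorname{ad}(X)\circ\varphi$ for all $X\in\mathfrak g$; let $\Omega^p_{\mathrm{hor}}(M;\mathfrak g)^{\mathfrak g}$ be the space of horizontal $\mathfrak g$-equivariant $\mathfrak g$-valued $p$-forms. For $\varphi\in\Omega^p(M;\mathfrak g)$ let $\zeta_\varphi\in\Omega^p(M;TM)$ be $(\zeta_\varphi)_x(v_1,\dots,v_p)=\zeta_{\varphi_x(v_1,\dots,v_p)}(x)$, and for $\varphi\in\Omega^p(M;\mathfrak g)$, $\psi\in\Omega^q(M;\mathfrak g)$ let $$[\varphi,\psi]^\wedge(v_1,\dots,v_{p+q})=\frac1{p!\,q!}\sum_{\sigma}\operatorname{sign}(\sigma)\,[\varphi(v_{\sigma1},\dots,v_{\sigma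 p}),\psi(v_{\sigma(p+1)},\dots,v_{\sigma(p+q)})].$$ On $\Omega(M;TM)$, $[\ ,\ ]$ denotes the Frölicher–Nijenhuis bracket, given for $K\in\Omega^k(M;TM)$, $L\in\Omega^\ell(M;TM)$ and vector fields $\xi_i$ by $$\begin{aligned}{}[K,L](\xi_1,\dots,\xi_{k+\ell})&=\tfrac1{k!\,\ell!}\sum_\sigma\operatorname{sign}\sigma\,[K(\xi_{\sigma1},\dots,\xi_{\sigma k}),L(\xi_{\sigma(k+1)},\dots,\xi_{\sigma(k+\ell)})]\\ &-\tfrac1{k!\,(\ell-1)!}\sum_\sigma\operatorname{sign}\sigma\,L([K(\xi_{\sigma1},\dots,\xi_{\sigma k}),\xi_{\sigma(k+1)}],\xi_{\sigma(k+2)},\dots)\\ &+\tfrac{(-1)^{k\ell}}{(k-1)!\,\ell!}\sum_\sigma\operatorname{sign}\sigma\,K([L(\xi_{\sigma1},\dots,\xi_{\sigma\ell}),\xi_{\sigma(\ell+1)}],\xi_{\sigma(\ell+2)},\dots)\\ &+\tfrac{(-1)^{k-1}}{(k-1)!\,(\ell-1)!\,2!}\sum_\sigma\operatorname{sign}\sigma\,L(K([\xi_{\sigma1},\xi_{\sigma2}],\xi_{\sigma3},\dots),\xi_{\sigma(k+2)},\dots)\\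 &+\tfrac{(-1)^{(k-1)\ell}}{(k-1)!\,(\ell-1)!\,2!}\sum_\sigma\operatorname{sign}\sigma\,K(L([\xi_{\sigma1},\xi_{\sigma2}],\xi_{\sigma3},\dots),\xi_{\sigma(\ell+2)},\dots),\end{aligned}$$ where terms containing $(k-1)!$ (resp. $(\ell-1)!$) are absent if $k=0$ (resp. $\ell=0$). A *principal connection form* is a $\mathfrak g$-equivariant $\omega\in\Omega^1(M;\mathfrak g)$ with $\zeta_x\circ\omega_x\circ\zeta_x=\zeta_x$ for all $x\in M$, where $\zeta_x:\mathfrak g\to T_xM$, $X\mapsto\zeta_X(x)$; put $\Phi:=\zeta_\omega$. **Proposition.** Let $\varphi\in\Omega^p_{\mathrm{hor}}(M;\mathfrak g)^{\mathfrak g}$ and $\psi\in\Omega^q_{\mathrm{hor}}(M;\mathfrak g)^{\mathfrak g}$, $p,q\ge0$. Then: 1. $\zeta_\psi$ is horizontal, and $\mathcal L_{\zeta_X}(\zeta_\psi)=[\zeta_X,\zeta_\psi]=0$ for all $X\in\mathfrak g$. 2. $[\varphi,\psi]^\wedge\in\Omega^{p+q}_{\mathrm{hor}}(M;\mathfrak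 g)^{\mathfrak g}$ and $[\zeta_\varphi,\zeta_\psi]=-\zeta_{[\varphi,\psi]^\wedge}$; so the linear map $\zeta:\Omega_{\mathrm{hor}}(M;\mathfrak g)^{\mathfrak g}\to\Omega(M;TM)$ is an anti-homomorphism of graded Lie algebras. If $\omega$ is a principal connection form and $\Phi=\zeta_\omega$, then moreover: 3. $[\Phi,\zeta_\psi]=-\zeta_{d\psi+[\omega,\psi]^\wedge}$. 4. $\tfrac12[\Phi,\Phi]=-\zeta_{d\omega+\frac12[\omega,\omega]^\wedge}$. -/

import Mathlib

open scoped Manifold ContDiff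

noncomputable section

namespace GManifold

/-! ### Lie algebras

A finite dimensional real Lie algebra is written with an auxiliary norm, which is only used to speak
about smooth functions with values in it. No compatibility of the norm with the bracket is required;
every finite dimensional real Lie algebra carries such norms and they all give the same notion of
smoothness. -/

/-- A Lie ring which carries a norm (with the same underlying additive group). -/
class NormedLieRing (𝔤 : Type*) extends NormedAddCommGroup 𝔤, LieRing 𝔤

/-- A real Lie algebra which carries a norm (with the same underlying real vector space). -/
class NormedLieAlgebra (𝔤 : Type*) [NormedLieRing 𝔤] extends NormedSpace ℝ 𝔤, LieAlgebra ℝ 𝔤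

/-! ### The Lie algebra of vector fields -/

/-- The space `𝔛(M)` of smooth vector fields on `M`. -/
abbrev VectorFields (E : Type*) [NormedAddCommGroup E] [NormedSpace ℝ E]
    (M : Type*) [TopologicalSpace M] [ChartedSpace E M] [IsManifold 𝓘(ℝ, E) ∞ M] : Type _ :=
  Cₛ^∞⟮𝓘(ℝ, E); E, (TangentSpace 𝓘(ℝ, E) : M → Type _)⟯

theorem minSmoothness_le_infty (n : ℕ) : minSmoothness ℝ n ≤ ∞ := by
  rw [minSmoothness_of_isRCLikeNormedField]
  exact_mod_cast (le_top : (n : ℕ∞) ≤ ⊤)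

section Fields

variable {E : Type*} [NormedAddCommGroup E] [NormedSpace ℝ E] [FiniteDimensional ℝ E]
  {M : Type*} [TopologicalSpace M] [ChartedSpace E M] [IsManifold 𝓘(ℝ, E) ∞ M]

/-- The Lie bracket of two smooth vector fields. -/
instance : Bracket (VectorFields E M) (VectorFields E M) where
  bracket ξ η :=
    { toFun := VectorField.mlieBracket 𝓘(ℝ, E) ξ η
      contMDiff_toFun := by
        have : CompleteSpace E := FiniteDimensional.complete ℝ E
        have : IsManifold 𝓘(ℝ, E) (minSmoothness ℝ 2) M :=
          IsManifold.of_le (n := ∞) (minSmoothness_le_infty _)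
        have : IsManifold 𝓘(ℝ, E) (((⊤ : ℕ∞) : WithTop ℕ∞) + 1) M :=
          IsManifold.of_le (n := ∞) (by simp)
        intro x
        exact ContMDiffAt.mlieBracket_vectorField (m := ⊤) (n := ⊤) (ξ.contMDiff x)
          (η.contMDiff x) (by simp) }

/-- The Lie bracket makes `𝔛(M)` a Lie ring. -/
instance : LieRing (VectorFields E M) where
  add_lie ξ η θ := by
    ext x
    exact VectorField.mlieBracket_add_left ξ.mdifferentiableAt η.mdifferentiableAt
  lie_add ξ η θ := by
    ext x
    exact VectorField.mlieBracket_add_right η.mdifferentiableAt θ.mdifferentiableAt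
  lie_self ξ := by
    ext x
    exact congrFun (VectorField.mlieBracket_self (I := 𝓘(ℝ, E)) (V := ξ)) x
  leibniz_lie ξ η θ := by
    ext x
    have : CompleteSpace E := FiniteDimensional.complete ℝ E
    have : IsManifold 𝓘(ℝ, E) (minSmoothness ℝ 3) M :=
      IsManifold.of_le (n := ∞) (minSmoothness_le_infty _)
    have h : minSmoothness ℝ 2 ≤ ∞ := minSmoothness_le_infty 2
    exact VectorField.leibniz_identity_mlieBracket_apply
      ((ξ.contMDiff x).of_le h) ((η.contMDiff x).of_le h) ((θ.contMDiff x).of_le h)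

/-- The Lie bracket makes `𝔛(M)` a real Lie algebra. -/
instance : LieAlgebra ℝ (VectorFields E M) where
  lie_smul c ξ η := by
    ext x
    exact VectorField.mlieBracket_const_smul_right η.mdifferentiableAt

end Fields

/-! ### Differential forms -/

section Forms

variable (E : Type*) [NormedAddCommGroup E] [NormedSpace ℝ E]
  (M : Type*) [TopologicalSpace M] [ChartedSpace E M] [IsManifold 𝓘(ℝ, E) ∞ M]

/-- `Ω^p(M; V)`: the `V`-valued smooth differential `p`-forms on `M`, i.e. the families of
alternating `p`-linear maps `φ_x : (T_x M)^p → V` such that `x ↦ φ_x(ξ₁(x), …, ξ_p(x))` is smooth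
for all smooth vector fields `ξ₁, …, ξ_p`. -/
def VForm (V : Type*) [NormedAddCommGroup V] [NormedSpace ℝ V] (p : ℕ) :
    Submodule ℝ (∀ x : M, TangentSpace 𝓘(ℝ, E) x [⋀^Fin p]→ₗ[ℝ] V) where
  carrier := {φ | ∀ ξ : Fin p → VectorFields E M,
    ContMDiff 𝓘(ℝ, E) 𝓘(ℝ, V) ∞ fun x => φ x fun i => ξ i x}
  add_mem' hφ hψ ξ := (hφ ξ).add (hψ ξ)
  zero_mem' _ := contMDiff_const
  smul_mem' c φ hφ ξ := by
    exact (contDiff_const_smul c).contMDiff.comp (hφ ξ)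

/-- `Ω^p(M; TM)`: the tangent bundle valued smooth differential `p`-forms on `M`, i.e. the families
of alternating `p`-linear maps `K_x : (T_x M)^p → T_x M` such that `x ↦ K_x(ξ₁(x), …, ξ_p(x))` is a
smooth vector field for all smooth vector fields `ξ₁, …, ξ_p`. -/
def TForm (p : ℕ) :
    Submodule ℝ (∀ x : M, TangentSpace 𝓘(ℝ, E) x [⋀^Fin p]→ₗ[ℝ] TangentSpace 𝓘(ℝ, E) x) where
  carrier := {K | ∀ ξ : Fin p → VectorFields E M, ContMDiff 𝓘(ℝ, E) 𝓘(ℝ, E).tangent ∞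
    fun x => (⟨x, K x fun i => ξ i x⟩ : TangentBundle 𝓘(ℝ, E) M)}
  add_mem' hK hL ξ := ContMDiff.add_section (hK ξ) (hL ξ)
  zero_mem' _ := (0 : VectorFields E M).contMDiff
  smul_mem' _ _ hK ξ := ContMDiff.const_smul_section (hK ξ)

variable {E M}

/-- The action of a vector valued form on vector fields: the function
`φ(ξ₁, …, ξ_p) : x ↦ φ_x(ξ₁(x), …, ξ_p(x))`. -/
def evalV {V : Type*} [NormedAddCommGroup V] [NormedSpace ℝ V] {p : ℕ}
    (φ : VForm E M V p) (ξ : Fin p → VectorFields E M) : M → V :=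
  fun x => φ.1 x fun i => ξ i x

/-- The action of a tangent bundle valued form on vector fields: the vector field
`K(ξ₁, …, ξ_p) : x ↦ K_x(ξ₁(x), …, ξ_p(x))`. -/
def evalT {p : ℕ} (K : TForm E M p) (ξ : Fin p → VectorFields E M) :
    VectorFields E M where
  toFun x := K.1 x fun i => ξ i x
  contMDiff_toFun := K.2 ξ

/-- A vector field, regarded as a tangent bundle valued `0`-form. -/
def fieldForm (X : VectorFields E M) : TForm E M 0 :=
  ⟨fun x => AlternatingMap.constOfIsEmpty ℝ (TangentSpace 𝓘(ℝ, E) x) (Fin 0) (X x),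
    fun _ => X.contMDiff⟩

/-- `argSeq ξ σ` is the sequence of vector fields `ξ_{σ(0)}, …, ξ_{σ(n-1)}` (numbered from `0`),
continued by `0`; the continuation is irrelevant in all the formulas below. -/
def argSeq {n : ℕ} (ξ : Fin n → VectorFields E M) (σ : Equiv.Perm (Fin n)) (i : ℕ) :
    VectorFields E M :=
  if h : i < n then ξ (σ ⟨i, h⟩) else 0

variable [FiniteDimensional ℝ E]

/-- The Lie derivative of a vector valued form, evaluated on vector fields:
`(L_X φ)(ξ₁, …, ξ_p) = X(φ(ξ₁, …, ξ_p)) - ∑ᵢ φ(ξ₁, …, [X, ξᵢ], …, ξ_p)`. -/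
def lieDerivV {V : Type*} [NormedAddCommGroup V] [NormedSpace ℝ V] {p : ℕ}
    (X : VectorFields E M) (φ : VForm E M V p) (ξ : Fin p → VectorFields E M) : M → V :=
  fun x => mvfderiv 𝓘(ℝ, E) (evalV φ ξ) x (X x)
    - ∑ i, evalV φ (Function.update ξ i ⁅X, ξ i⁆) x

/-- The Lie derivative of a tangent bundle valued form, evaluated on vector fields:
`(L_X K)(ξ₁, …, ξ_p) = [X, K(ξ₁, …, ξ_p)] - ∑ᵢ K(ξ₁, …, [X, ξᵢ], …, ξ_p)`. -/
def lieDerivT {p : ℕ} (X : VectorFields E M) (K : TForm E M p)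
    (ξ : Fin p → VectorFields E M) : VectorFields E M :=
  ⁅X, evalT K ξ⁆ - ∑ i, evalT K (Function.update ξ i ⁅X, ξ i⁆)

/-- The exterior derivative of a vector valued `q`-form, evaluated on vector fields. This is the
usual global formula, written as a sum over all permutations `σ`: with `ξ₀, …, ξ_q` the arguments,
`dψ(ξ₀, …, ξ_q) = 1/q! ∑_σ sign σ · ξ_{σ0}(ψ(ξ_{σ1}, …, ξ_{σq}))
  - 1/((q-1)! 2!) ∑_σ sign σ · ψ([ξ_{σ0}, ξ_{σ1}], ξ_{σ2}, …, ξ_{σq})`.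
The factor `1/(q-1)!` is written `q/q!`; so the second sum is absent for `q = 0`. -/
def extDerivV {V : Type*} [NormedAddCommGroup V] [NormedSpace ℝ V] {q : ℕ}
    (ψ : VForm E M V q) (ξ : Fin (1 + q) → VectorFields E M) : M → V :=
  fun x =>
    (1 / (q.factorial : ℝ)) • ∑ σ : Equiv.Perm (Fin (1 + q)), (Equiv.Perm.sign σ : ℤ) •
      mvfderiv 𝓘(ℝ, E) (evalV ψ fun j => argSeq ξ σ (1 + j)) x (argSeq ξ σ 0 x)
    - ((q : ℝ) / (q.factorial * 2)) • ∑ σ : Equiv.Perm (Fin (1 + q)), (Equiv.Perm.sign σ : ℤ) •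
      evalV ψ (fun j => if (j : ℕ) = 0 then ⁅argSeq ξ σ 0, argSeq ξ σ 1⁆
        else argSeq ξ σ (1 + j)) x

/-- The Frölicher-Nijenhuis bracket `[K, L]` of `K ∈ Ω^k(M; TM)` and `L ∈ Ω^l(M; TM)`, evaluated on
vector fields by the global formula: with `ξ₁, …, ξ_{k+l}` the arguments, `[K, L](ξ₁, …, ξ_{k+l})` is

`1/(k! l!) ∑_σ sign σ [K(ξ_{σ1}, …, ξ_{σk}), L(ξ_{σ(k+1)}, …, ξ_{σ(k+l)})]`
`- 1/(k! (l-1)!) ∑_σ sign σ L([K(ξ_{σ1}, …, ξ_{σk}), ξ_{σ(k+1)}], ξ_{σ(k+2)}, …)`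
`+ (-1)^{kl}/((k-1)! l!) ∑_σ sign σ K([L(ξ_{σ1}, …, ξ_{σl}), ξ_{σ(l+1)}], ξ_{σ(l+2)}, …)`
`+ (-1)^{k-1}/((k-1)! (l-1)! 2!) ∑_σ sign σ L(K([ξ_{σ1}, ξ_{σ2}], ξ_{σ3}, …), ξ_{σ(k+2)}, …)`
`+ (-1)^{(k-1)l}/((k-1)! (l-1)! 2!) ∑_σ sign σ K(L([ξ_{σ1}, ξ_{σ2}], ξ_{σ3}, …), ξ_{σ(l+2)}, …)`.

A factor `1/(k-1)!` is written `k/k!`, and likewise for `l`, so that the terms with `(k-1)!` are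
absent for `k = 0` and those with `(l-1)!` for `l = 0`; the exponents `k-1` are replaced by `k+1`,
of the same parity. In the code the arguments are numbered from `0`. -/
def fnBracket {k l : ℕ} (K : TForm E M k) (L : TForm E M l)
    (ξ : Fin (k + l) → VectorFields E M) : VectorFields E M :=
  (1 / (k.factorial * l.factorial : ℝ)) • ∑ σ : Equiv.Perm (Fin (k + l)), (Equiv.Perm.sign σ : ℤ) •
      ⁅evalT K fun i => argSeq ξ σ i, evalT L fun j => argSeq ξ σ (k + j)⁆
  - ((l : ℝ) / (k.factorial * l.factorial)) • ∑ σ : Equiv.Perm (Fin (k + l)), (Equiv.Perm.sign σ : ℤ) •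
      evalT L (fun j => if (j : ℕ) = 0
        then ⁅evalT K fun i => argSeq ξ σ i, argSeq ξ σ k⁆
        else argSeq ξ σ (k + j))
  + ((-1) ^ (k * l) * (k : ℝ) / (k.factorial * l.factorial)) •
      ∑ σ : Equiv.Perm (Fin (k + l)), (Equiv.Perm.sign σ : ℤ) •
        evalT K (fun i => if (i : ℕ) = 0
          then ⁅evalT L fun j => argSeq ξ σ j, argSeq ξ σ l⁆
          else argSeq ξ σ (l + i))
  + ((-1) ^ (k + 1) * (k * l : ℝ) / (k.factorial * l.factorial * 2)) •
      ∑ σ : Equiv.Perm (Fin (k + l)), (Equiv.Perm.sign σ : ℤ) •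
        evalT L (fun j => if (j : ℕ) = 0
          then evalT K fun i => if (i : ℕ) = 0
            then ⁅argSeq ξ σ 0, argSeq ξ σ 1⁆ else argSeq ξ σ (1 + i)
          else argSeq ξ σ (k + j))
  + ((-1) ^ ((k + 1) * l) * (k * l : ℝ) / (k.factorial * l.factorial * 2)) •
      ∑ σ : Equiv.Perm (Fin (k + l)), (Equiv.Perm.sign σ : ℤ) •
        evalT K (fun i => if (i : ℕ) = 0
          then evalT L fun j => if (j : ℕ) = 0
            then ⁅argSeq ξ σ 0, argSeq ξ σ 1⁆ else argSeq ξ σ (1 + j)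
          else argSeq ξ σ (l + i))

end Forms

/-! ### Lie algebra valued forms -/

section LieForms

variable {E : Type*} [NormedAddCommGroup E] [NormedSpace ℝ E] [FiniteDimensional ℝ E]
  {M : Type*} [TopologicalSpace M] [ChartedSpace E M] [IsManifold 𝓘(ℝ, E) ∞ M]
  {𝔤 : Type*} [NormedLieRing 𝔤] [NormedLieAlgebra 𝔤]

/-- The `(p + q)`-linear map `(v₁, …, v_{p+q}) ↦ [a(v₁, …, v_p), b(v_{p+1}, …, v_{p+q})]`. -/
def lieTensor {T : Type*} [AddCommGroup T] [Module ℝ T] {p q : ℕ}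
    (a : T [⋀^Fin p]→ₗ[ℝ] 𝔤) (b : T [⋀^Fin q]→ₗ[ℝ] 𝔤) :
    MultilinearMap ℝ (fun _ : Fin (p + q) => T) 𝔤 :=
  MultilinearMap.domDomCongr finSumFinEquiv
    (((LieModule.toModuleHom ℝ 𝔤 𝔤 : TensorProduct ℝ 𝔤 𝔤 →ₗ[ℝ] 𝔤)).compMultilinearMap
      (MultilinearMap.domCoprod a.toMultilinearMap b.toMultilinearMap))

theorem lieTensor_apply {T : Type*} [AddCommGroup T] [Module ℝ T] {p q : ℕ}
    (a : T [⋀^Fin p]→ₗ[ℝ] 𝔤) (b : T [⋀^Fin q]→ₗ[ℝ] 𝔤) (v : Fin (p + q) → T) :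
    lieTensor a b v = ⁅a fun i => v (Fin.castAdd q i), b fun j => v (Fin.natAdd p j)⁆ := by
  simp [lieTensor]

variable [FiniteDimensional ℝ 𝔤]

/-- The bracket `[φ, ψ]^∧ ∈ Ω^{p+q}(M; 𝔤)` of `φ ∈ Ω^p(M; 𝔤)` and `ψ ∈ Ω^q(M; 𝔤)`:
`[φ, ψ]^∧(v₁, …, v_{p+q})
  = 1/(p! q!) ∑_σ sign σ [φ(v_{σ1}, …, v_{σp}), ψ(v_{σ(p+1)}, …, v_{σ(p+q)})]`. -/
def wedgeBracket {p q : ℕ} (φ : VForm E M 𝔤 p) (ψ : VForm E M 𝔤 q) : VForm E M 𝔤 (p + q) :=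
  ⟨fun x => (1 / (p.factorial * q.factorial : ℝ)) • MultilinearMap.alternatization (lieTensor (φ.1 x) (ψ.1 x)), by
    change ∀ ξ : Fin (p + q) → VectorFields E M, ContMDiff 𝓘(ℝ, E) 𝓘(ℝ, 𝔤) ∞ _
    intro ξ
    have hB : ∀ f g : M → 𝔤, ContMDiff 𝓘(ℝ, E) 𝓘(ℝ, 𝔤) ∞ f → ContMDiff 𝓘(ℝ, E) 𝓘(ℝ, 𝔤) ∞ g →
        ContMDiff 𝓘(ℝ, E) 𝓘(ℝ, 𝔤) ∞ fun x => ⁅f x, g x⁆ := by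
      intro f g hf hg
      have hb := ((LieModule.toEnd ℝ 𝔤 𝔤 : 𝔤 →ₗ[ℝ] 𝔤 →ₗ[ℝ] 𝔤)).toContinuousBilinearMap.isBoundedBilinearMap
      exact hb.contDiff.contMDiff.comp (hf.prodMk_space hg)
    simp only [AlternatingMap.smul_apply, MultilinearMap.alternatization_apply,
      MultilinearMap.domDomCongr_apply, lieTensor_apply]
    refine (contDiff_const_smul _).contMDiff.comp (contMDiff_finsetSum fun σ _ => ?_)
    simp only [Units.smul_def, ← Int.cast_smul_eq_zsmul ℝ]
    exact (contDiff_const_smul _).contMDiff.comp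
      (hB _ _ (φ.2 fun i => ξ (σ (Fin.castAdd q i))) (ψ.2 fun j => ξ (σ (Fin.natAdd p j))))⟩

variable (ζ : 𝔤 →ₗ⁅ℝ⁆ VectorFields E M)

/-- The linear map `ζ_x : 𝔤 → T_x M`, `X ↦ ζ_X(x)`, of an action `ζ : 𝔤 → 𝔛(M)`. -/
def actionAt (x : M) : 𝔤 →ₗ[ℝ] TangentSpace 𝓘(ℝ, E) x where
  toFun X := ζ X x
  map_add' X Y := by simp
  map_smul' c X := by simp

/-- The linear map `ζ : Ω^p(M; 𝔤) → Ω^p(M; TM)` of an action `ζ : 𝔤 → 𝔛(M)`: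
`(ζ_φ)_x(v₁, …, v_p) = ζ_{φ_x(v₁, …, v_p)}(x)`. -/
def zeta (p : ℕ) : VForm E M 𝔤 p →ₗ[ℝ] TForm E M p where
  toFun φ := ⟨fun x => (actionAt ζ x).compAlternatingMap (φ.1 x), by
    change ∀ ξ : Fin p → VectorFields E M, ContMDiff 𝓘(ℝ, E) 𝓘(ℝ, E).tangent ∞ _
    intro ξ
    have hφ : ∀ ξ : Fin p → VectorFields E M, ContMDiff 𝓘(ℝ, E) 𝓘(ℝ, 𝔤) ∞ (evalV φ ξ) := φ.2
    let b := Module.finBasis ℝ 𝔤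
    change ContMDiff 𝓘(ℝ, E) 𝓘(ℝ, E).tangent ∞
      fun x => (⟨x, actionAt ζ x (evalV φ ξ x)⟩ : TangentBundle 𝓘(ℝ, E) M)
    have h' : ∀ x, actionAt ζ x (evalV φ ξ x) =
        ∑ i, (b.coord i (evalV φ ξ x)) • ζ (b i) x := by
      intro x
      conv_lhs => rw [← b.sum_repr (evalV φ ξ x), map_sum]
      simp only [map_smul]
      rfl
    simp only [h']
    refine ContMDiff.sum_section fun i _ => ?_
    refine ContMDiff.smul_section ?_ (ζ (b i)).contMDiff
    exact (LinearMap.toContinuousLinearMap (b.coord i)).contDiff.contMDiff.comp (hφ ξ)⟩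
  map_add' φ ψ := by
    ext x v
    simp
  map_smul' c φ := by
    ext x v
    simp

/-- A vector valued form is horizontal if it vanishes whenever one of its arguments is the value of
a fundamental vector field `ζ_X`. -/
def IsHorizontalV {p : ℕ} (φ : VForm E M 𝔤 p) : Prop :=
  ∀ (x : M) (v : Fin p → TangentSpace 𝓘(ℝ, E) x) (i : Fin p) (X : 𝔤), v i = ζ X x → φ.1 x v = 0

/-- A tangent bundle valued form is horizontal if it vanishes whenever one of its arguments is the
value of a fundamental vector field `ζ_X`. -/
def IsHorizontalT {p : ℕ} (K : TForm E M p) : Prop :=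
  ∀ (x : M) (v : Fin p → TangentSpace 𝓘(ℝ, E) x) (i : Fin p) (X : 𝔤), v i = ζ X x → K.1 x v = 0

/-- A `𝔤`-valued form `φ` is `𝔤`-equivariant if `L_{ζ_X} φ = -ad(X) ∘ φ` for all `X ∈ 𝔤`. -/
def IsEquivariant {p : ℕ} (φ : VForm E M 𝔤 p) : Prop :=
  ∀ (X : 𝔤) (ξ : Fin p → VectorFields E M) (x : M),
    lieDerivV (ζ X) φ ξ x = -⁅X, evalV φ ξ x⁆

/-- `φ ∈ Ω_hor^p(M; 𝔤)^𝔤`, i.e. the form `φ` is horizontal and `𝔤`-equivariant. -/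
structure IsBasic {p : ℕ} (φ : VForm E M 𝔤 p) : Prop where
  horizontal : IsHorizontalV ζ φ
  equivariant : IsEquivariant ζ φ

/-- A principal connection form: a `𝔤`-equivariant `𝔤`-valued `1`-form `w` such that
`ζ_x ∘ w_x ∘ ζ_x = ζ_x` for all `x ∈ M`. -/
structure IsPrincipalConnectionForm (w : VForm E M 𝔤 1) : Prop where
  equivariant : IsEquivariant ζ w
  action_comp : ∀ (x : M) (X : 𝔤), ζ (w.1 x fun _ => ζ X x) x = ζ X x

end LieForms

end GManifold

end

open GManifold

/-! For smooth `f : M → 𝔤` write `ζ_f` for the field `x ↦ ζ_{f(x)}(x)`. The engine is the Leibniz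
rule `[X, ζ_f] = ζ_{df(X)} + [X, ζ_{f(x)}]` at `x`, with `f(x)` frozen in the last term
(`lie_action_comp_apply`). In the global formula for `[ζ_φ, ζ_ψ]` each permutation contributes
`[ζ_φ, ζ_ψ]`, minus `ζ_ψ` with `[ζ_φ, ξ_j]` inserted, plus `ζ_φ` with `[ζ_ψ, ξ_i]` inserted. The
insertions sit in the first slot only; antisymmetry spreads them over all slots
(`sum_sign_smul_sum_update`), so that they become the sums occurring in Lie derivatives.
Equivariance evaluates these, every derivative along a `ζ`-value cancels, and one `-[φ, ψ]`
survives, together with corrections in which `φ` or `ψ` has a `ζ`-value as an argument. This is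
`IsEquivariant.fnBracket_zeta_apply`, which needs no horizontality. The three bracket formulas are
specializations. If both forms are horizontal, all corrections vanish. For `ω` and horizontal `ψ`,
the identity `ζ ∘ ω ∘ ζ = ζ` turns the remaining corrections into the two sums of `-dψ`. For `ω` and
`ω`, both groups of corrections survive and give `-2 dω`, whence the factor `1/2`. -/

namespace GManifold

/-! ### Derivatives of vector valued functions on a manifold -/

section Calculus

variable {E : Type*} [NormedAddCommGroup E] [NormedSpace ℝ E]
  {M : Type*} [TopologicalSpace M] [ChartedSpace E M]
  {V W : Type*} [NormedAddCommGroup V] [NormedSpace ℝ V] [NormedAddCommGroup W] [NormedSpace ℝ W]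
  {Z : Type*} [NormedAddCommGroup Z] [NormedSpace ℝ Z]

theorem mvfderiv_bilin_apply (B : V →L[ℝ] W →L[ℝ] Z) {f : M → V} {g : M → W} {x : M}
    (hf : MDifferentiableAt 𝓘(ℝ, E) 𝓘(ℝ, V) f x) (hg : MDifferentiableAt 𝓘(ℝ, E) 𝓘(ℝ, W) g x)
    (v : TangentSpace 𝓘(ℝ, E) x) :
    mvfderiv 𝓘(ℝ, E) (fun y => B (f y) (g y)) x v
      = B (mvfderiv 𝓘(ℝ, E) f x v) (g x) + B (f x) (mvfderiv 𝓘(ℝ, E) g x v) := by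
  have hfg : MDifferentiableAt 𝓘(ℝ, E) 𝓘(ℝ, Z) (fun y => B (f y) (g y)) x :=
    (B.isBoundedBilinearMap.differentiableAt (f x, g x)).mdifferentiableAt.comp x
      (hf.prodMk_space hg)
  have h := B.fderivWithin_of_bilinear hf.differentiableWithinAt_writtenInExtChartAt
    hg.differentiableWithinAt_writtenInExtChartAt (by simp)
  -- For differentiable maps `mvfderiv` is the derivative in a chart, which reduces the claim to the
  -- product rule in a normed space.
  rw [hf.mvfderiv, hg.mvfderiv, hfg.mvfderiv]
  refine (DFunLike.congr_fun h v).trans ?_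
  rw [add_comm]
  simp [writtenInExtChartAt]
  rfl

theorem mvfderiv_clm_apply (L : V →L[ℝ] W) {f : M → V} {x : M}
    (hf : MDifferentiableAt 𝓘(ℝ, E) 𝓘(ℝ, V) f x) (v : TangentSpace 𝓘(ℝ, E) x) :
    mvfderiv 𝓘(ℝ, E) (fun y => L (f y)) x v = L (mvfderiv 𝓘(ℝ, E) f x v) := by
  have h : MDifferentiableAt 𝓘(ℝ, E) 𝓘(ℝ, W) (fun y => L (f y)) x :=
    L.differentiableAt.mdifferentiableAt.comp x hf
  rw [hf.mvfderiv, h.mvfderiv]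
  exact DFunLike.congr_fun ((L.hasFDerivAt.comp_hasFDerivWithinAt _
    hf.differentiableWithinAt_writtenInExtChartAt.hasFDerivWithinAt).fderivWithin (by simp)) v

theorem mvfderiv_sum_apply {ι : Type*} (s : Finset ι) {f : ι → M → V} {x : M}
    (hf : ∀ i ∈ s, ContMDiff 𝓘(ℝ, E) 𝓘(ℝ, V) ∞ (f i)) (v : TangentSpace 𝓘(ℝ, E) x) :
    mvfderiv 𝓘(ℝ, E) (fun y => ∑ i ∈ s, f i y) x v = ∑ i ∈ s, mvfderiv 𝓘(ℝ, E) (f i) x v := by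
  classical
  induction s using Finset.induction_on with
  | empty => simp [mvfderiv_const]
  | insert i s hi ih =>
    have hs : ∀ j ∈ s, ContMDiff 𝓘(ℝ, E) 𝓘(ℝ, V) ∞ (f j) :=
      fun j hj => hf j (Finset.mem_insert_of_mem hj)
    simp only [Finset.sum_insert hi]
    rw [mvfderiv_fun_add ((hf i (Finset.mem_insert_self i s)).mdifferentiableAt (by simp))
      ((contMDiff_finsetSum hs).mdifferentiableAt (by simp)), ← ih hs]
    rfl

end Calculus

section Evaluation

variable {E : Type*} [NormedAddCommGroup E] [NormedSpace ℝ E]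
  {M : Type*} [TopologicalSpace M] [ChartedSpace E M] [IsManifold 𝓘(ℝ, E) ∞ M]

/-- The value of a vector field at a point, as a linear map. -/
noncomputable def VectorFields.valueAt (x : M) : VectorFields E M →ₗ[ℝ] TangentSpace 𝓘(ℝ, E) x where
  toFun F := F x
  map_add' _ _ := rfl
  map_smul' _ _ := rfl

theorem VectorFields.valueAt_apply (x : M) (F : VectorFields E M) : valueAt x F = F x := rfl

theorem VectorFields.sum_apply {ι : Type*} (s : Finset ι) (F : ι → VectorFields E M) (x : M) :
    (∑ i ∈ s, F i) x = ∑ i ∈ s, F i x :=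
  map_sum (valueAt x) F s

end Evaluation

/-! ### The Leibniz rule for fields with values in the action -/

section Fields

variable {E : Type*} [NormedAddCommGroup E] [NormedSpace ℝ E] [FiniteDimensional ℝ E]
  {M : Type*} [TopologicalSpace M] [ChartedSpace E M] [IsManifold 𝓘(ℝ, E) ∞ M]

/-- The product of a smooth function and a smooth vector field. -/
noncomputable def smulField (f : M → ℝ) (hf : ContMDiff 𝓘(ℝ, E) 𝓘(ℝ, ℝ) ∞ f) (Y : VectorFields E M) :
    VectorFields E M where
  toFun x := f x • Y x
  contMDiff_toFun := ContMDiff.smul_section hf Y.contMDiff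

theorem lie_smulField_apply (X Y : VectorFields E M) (f : M → ℝ)
    (hf : ContMDiff 𝓘(ℝ, E) 𝓘(ℝ, ℝ) ∞ f) (x : M) :
    (⁅X, smulField f hf Y⁆ : VectorFields E M) x
      = mvfderiv 𝓘(ℝ, E) f x (X x) • Y x + f x • (⁅X, Y⁆ : VectorFields E M) x := by
  have : CompleteSpace E := FiniteDimensional.complete ℝ E
  have : IsManifold 𝓘(ℝ, E) (minSmoothness ℝ 2) M :=
    IsManifold.of_le (n := ∞) (minSmoothness_le_infty _)
  exact VectorField.mlieBracket_smul_right (hf.mdifferentiableAt (by simp)) Y.mdifferentiableAt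

theorem lie_skew_apply (X Y : VectorFields E M) (x : M) :
    (⁅X, Y⁆ : VectorFields E M) x = -(⁅Y, X⁆ : VectorFields E M) x := by
  rw [← lie_skew]; rfl

variable {𝔤 : Type*} [NormedLieRing 𝔤] [NormedLieAlgebra 𝔤] [FiniteDimensional ℝ 𝔤]
  (ζ : 𝔤 →ₗ⁅ℝ⁆ VectorFields E M)

/-- The Leibniz rule for a field of the form `x ↦ ζ_{f(x)}(x)`. -/
theorem lie_action_comp_apply (X F : VectorFields E M) (f : M → 𝔤)
    (hf : ContMDiff 𝓘(ℝ, E) 𝓘(ℝ, 𝔤) ∞ f) (hF : ∀ x, F x = ζ (f x) x) (x : M) :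
    (⁅X, F⁆ : VectorFields E M) x
      = ζ (mvfderiv 𝓘(ℝ, E) f x (X x)) x + (⁅X, ζ (f x)⁆ : VectorFields E M) x := by
  let b := Module.finBasis ℝ 𝔤
  let c i : 𝔤 →L[ℝ] ℝ := LinearMap.toContinuousLinearMap (b.coord i)
  have hc i : ContMDiff 𝓘(ℝ, E) 𝓘(ℝ, ℝ) ∞ fun x => c i (f x) :=
    (c i).contDiff.contMDiff.comp hf
  have hexp (Y : 𝔤) : ζ Y = ∑ i, c i Y • ζ (b i) := by
    conv_lhs => rw [← b.sum_repr Y, map_sum]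
    simp only [map_smul]
    rfl
  -- In a basis of `𝔤` only the scalar coefficients vary with the point, so the Leibniz rule for
  -- function times field applies.
  have hF' : F = ∑ i, smulField (fun x => c i (f x)) (hc i) (ζ (b i)) := by
    ext x
    rw [hF, hexp, VectorFields.sum_apply, VectorFields.sum_apply]
    rfl
  rw [hF', lie_sum, VectorFields.sum_apply]
  simp only [lie_smulField_apply, Finset.sum_add_distrib]
  congr 1
  · rw [hexp, VectorFields.sum_apply]
    refine Finset.sum_congr rfl fun i _ => ?_
    rw [mvfderiv_clm_apply (c i) (hf.mdifferentiableAt (by simp))]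
    rfl
  · rw [hexp (f x), lie_sum, VectorFields.sum_apply]
    refine Finset.sum_congr rfl fun i _ => ?_
    rw [lie_smul]
    rfl

end Fields

/-! ### Block permutations and antisymmetrized sums -/

section Permutations

/-- The permutation of `Fin (p + q)` moving the initial block of length `q` to the end and the
final block of length `p` to the beginning. -/
def blockSwap (p q : ℕ) : Equiv.Perm (Fin (p + q)) :=
  (finCongr (Nat.add_comm p q)).trans finAddFlip

theorem blockSwap_of_lt {p q j : ℕ} (hj : j < q) (h : j < p + q) :
    blockSwap p q ⟨j, h⟩ = Fin.natAdd p ⟨j, hj⟩ := by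
  ext
  simp [blockSwap, finAddFlip_apply_mk_left hj]

theorem blockSwap_add {p q i : ℕ} (hi : i < p) (h : q + i < p + q) :
    blockSwap p q ⟨q + i, h⟩ = Fin.castAdd q ⟨i, hi⟩ := by
  ext
  simp [blockSwap]

theorem coe_finRotate_pow {n : ℕ} (m : ℕ) (i : Fin n) :
    (((finRotate n) ^ m) i : ℕ) = (i + m) % n := by
  induction m with
  | zero => simp [Nat.mod_eq_of_lt i.2]
  | succ m ih =>
    obtain _ | n := n
    · exact i.elim0
    rw [pow_succ', Equiv.Perm.mul_apply, finRotate_apply, Fin.val_add, ih]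
    simp [← add_assoc]

/-- Both maps are `i ↦ i + p` modulo `p + q`; the sign of a rotation is known. -/
theorem blockSwap_eq_finRotate_pow (p q : ℕ) : blockSwap p q = finRotate (p + q) ^ p := by
  ext ⟨i, hi⟩
  rw [coe_finRotate_pow]
  rcases lt_or_ge i q with h | h
  · rw [blockSwap_of_lt h]
    simp [Nat.mod_eq_of_lt (show p + i < p + q by omega), add_comm i p]
  · obtain ⟨j, rfl⟩ := Nat.exists_eq_add_of_le h
    rw [blockSwap_add (by omega)]
    have : q + j + p = j + (p + q) := by omega
    simp [this, Nat.mod_eq_of_lt (show j < p + q by omega)]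

theorem sign_blockSwap (p q : ℕ) : Equiv.Perm.sign (blockSwap p q) = (-1) ^ (p * q) := by
  rw [blockSwap_eq_finRotate_pow, map_pow, sign_finRotate, ← pow_mul]
  obtain _ | p := p
  · simp
  -- One rotation has sign `(-1) ^ (n - 1)`. The product of consecutive integers is even, which
  -- leaves only the mixed product.
  have : (p + 1 + q - 1) * (p + 1) = p * (p + 1) + (p + 1) * q := by
    rw [show p + 1 + q - 1 = p + q by omega]; ring
  rw [this, pow_add, (Nat.even_mul_succ_self p).neg_one_pow, one_mul]

variable {α V : Type*} [AddCommGroup V] [Module ℝ V]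

/-- In a sum over all permutations, the alternating function `A` may be modified in its first
argument only. -/
theorem sum_sign_smul_sum_update {n p q : ℕ} (A : (Fin q → α) → V)
    (hA : ∀ v i j, i ≠ j → A (v ∘ Equiv.swap i j) = -A v)
    (e : Fin q → Fin n) (he : Function.Injective e) (e' : Fin p → Fin n)
    (hee' : ∀ i j, e i ≠ e' j) (D : (Fin p → Fin n) → Fin n → α) (u : Fin n → α) :
    ∑ σ : Equiv.Perm (Fin n), (Equiv.Perm.sign σ : ℤ) • ∑ j,
        A (Function.update (fun j => u (σ (e j))) j (D (fun i => σ (e' i)) (σ (e j))))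
      = (q : ℝ) • ∑ σ : Equiv.Perm (Fin n), (Equiv.Perm.sign σ : ℤ) •
        A fun j => if (j : ℕ) = 0 then D (fun i => σ (e' i)) (σ (e j)) else u (σ (e j)) := by
  simp only [Finset.smul_sum (s := (Finset.univ : Finset (Fin q)))]
  rw [Finset.sum_comm]
  obtain _ | q := q
  · simp
  suffices h : ∀ j : Fin (q + 1), ∑ σ : Equiv.Perm (Fin n), (Equiv.Perm.sign σ : ℤ) •
        A (Function.update (fun j => u (σ (e j))) j (D (fun i => σ (e' i)) (σ (e j))))
      = ∑ σ : Equiv.Perm (Fin n), (Equiv.Perm.sign σ : ℤ) •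
        A fun j => if (j : ℕ) = 0 then D (fun i => σ (e' i)) (σ (e j)) else u (σ (e j)) by
    simp only [h, Finset.sum_const, Finset.card_univ, Fintype.card_fin, Nat.cast_smul_eq_nsmul]
  intro j
  have h0 (σ : Equiv.Perm (Fin n)) :
      (fun j : Fin (q + 1) => if (j : ℕ) = 0 then D (fun i => σ (e' i)) (σ (e j))
        else u (σ (e j)))
      = Function.update (fun j => u (σ (e j))) 0 (D (fun i => σ (e' i)) (σ (e 0))) := by
    funext k
    by_cases hk : k = 0
    · simp [hk]
    · simp [hk, Fin.val_eq_zero_iff]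
  simp only [h0]
  by_cases hj : j = 0
  · rw [hj]
  -- Exchanging the slots `0` and `j` changes both the sign of the permutation and the sign of `A`.
  -- The arguments of `D` indexed by `e'` stay put, because the ranges of `e` and `e'` are disjoint.
  refine Fintype.sum_equiv (Equiv.mulRight (Equiv.swap (e 0) (e j))) _ _ fun σ => ?_
  have h1 (i : Fin p) : Equiv.swap (e 0) (e j) (e' i) = e' i :=
    Equiv.swap_apply_of_ne_of_ne (hee' 0 i).symm (hee' j i).symm
  have h2 (k : Fin (q + 1)) : Equiv.swap (e 0) (e j) (e k) = e (Equiv.swap 0 j k) :=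
    (he.map_swap 0 j k).symm
  have h3 : Function.update (fun k => u (σ (e (Equiv.swap 0 j k)))) 0
        (D (fun i => σ (e' i)) (σ (e j)))
      = Function.update (fun k => u (σ (e k))) j (D (fun i => σ (e' i)) (σ (e j)))
          ∘ Equiv.swap 0 j := by
    funext k
    by_cases hk : k = 0
    · simp [hk]
    · have : Equiv.swap 0 j k ≠ j := by
        rw [Ne, Equiv.swap_apply_eq_iff, Equiv.swap_apply_right]; exact hk
      simp [hk, this]
  simp only [Equiv.coe_mulRight, Equiv.Perm.mul_apply, h1, h2, Equiv.swap_apply_left, h3,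
    hA _ _ _ (Ne.symm hj), map_mul, Equiv.Perm.sign_swap (he.ne (Ne.symm hj))]
  simp

end Permutations

/-! ### The Frölicher-Nijenhuis bracket with insertions in all slots -/

section Bracket

variable {E : Type*} [NormedAddCommGroup E] [NormedSpace ℝ E]
  {M : Type*} [TopologicalSpace M] [ChartedSpace E M] [IsManifold 𝓘(ℝ, E) ∞ M]

theorem evalT_comp_swap_apply {p : ℕ} (K : TForm E M p) (x : M) (v : Fin p → VectorFields E M)
    (i j : Fin p) (hij : i ≠ j) :
    evalT K (v ∘ Equiv.swap i j) x = -evalT K v x :=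
  (K.1 x).map_swap (fun i => v i x) hij

theorem argSeq_coe_left {k l : ℕ} (ξ : Fin (k + l) → VectorFields E M)
    (σ : Equiv.Perm (Fin (k + l))) (i : Fin k) : argSeq ξ σ i = ξ (σ (Fin.castAdd l i)) := by
  rw [argSeq, dif_pos (by omega)]
  rfl

theorem argSeq_coe_right {k l : ℕ} (ξ : Fin (k + l) → VectorFields E M)
    (σ : Equiv.Perm (Fin (k + l))) (j : Fin l) :
    argSeq ξ σ (k + j) = ξ (σ (Fin.natAdd k j)) := by
  rw [argSeq, dif_pos (by omega)]
  rfl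

/-- Terms of the bracket that feed `L` first number its arguments first; composing with `blockSwap`
restores the numbering with the `K`-block in front. -/
theorem argSeq_mul_blockSwap_left {k l : ℕ} (ξ : Fin (k + l) → VectorFields E M)
    (σ : Equiv.Perm (Fin (k + l))) (j : Fin l) :
    argSeq ξ (σ * blockSwap k l) j = ξ (σ (Fin.natAdd k j)) := by
  rw [argSeq, dif_pos (by omega), Equiv.Perm.mul_apply, blockSwap_of_lt j.2]

theorem argSeq_mul_blockSwap_right {k l : ℕ} (ξ : Fin (k + l) → VectorFields E M)
    (σ : Equiv.Perm (Fin (k + l))) (i : Fin k) :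
    argSeq ξ (σ * blockSwap k l) (l + i) = ξ (σ (Fin.castAdd l i)) := by
  rw [argSeq, dif_pos (by omega), Equiv.Perm.mul_apply, blockSwap_add i.2]

variable [FiniteDimensional ℝ E]

theorem sum_evalT_lie_left {k l : ℕ} (K : TForm E M k) (L : TForm E M l)
    (ξ : Fin (k + l) → VectorFields E M) (x : M) :
    (l : ℝ) • ∑ σ : Equiv.Perm (Fin (k + l)), (Equiv.Perm.sign σ : ℤ) •
        evalT L (fun j => if (j : ℕ) = 0
          then ⁅evalT K fun i => argSeq ξ σ i, argSeq ξ σ k⁆ else argSeq ξ σ (k + j)) x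
      = ∑ σ : Equiv.Perm (Fin (k + l)), (Equiv.Perm.sign σ : ℤ) • ∑ j,
        evalT L (Function.update (fun j => ξ (σ (Fin.natAdd k j))) j
          ⁅evalT K fun i => ξ (σ (Fin.castAdd l i)), ξ (σ (Fin.natAdd k j))⁆) x := by
  rw [sum_sign_smul_sum_update (p := k) (fun v => evalT L v x) (evalT_comp_swap_apply L x)
    (Fin.natAdd k) (Fin.natAdd_injective l k) (Fin.castAdd l) (fun i j => by simp [Fin.ext_iff]; omega)
    (fun s m => ⁅evalT K fun i => ξ (s i), ξ m⁆) ξ]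
  congr! 6 with σ _ j
  split_ifs with hj
  · have := argSeq_coe_right ξ σ j
    rw [hj, add_zero] at this
    simp only [argSeq_coe_left, this]
  · exact argSeq_coe_right ξ σ j

theorem sum_evalT_lie_right {k l : ℕ} (K : TForm E M k) (L : TForm E M l)
    (ξ : Fin (k + l) → VectorFields E M) (x : M) :
    ((-1) ^ (k * l) * k : ℝ) • ∑ σ : Equiv.Perm (Fin (k + l)), (Equiv.Perm.sign σ : ℤ) •
        evalT K (fun i => if (i : ℕ) = 0
          then ⁅evalT L fun j => argSeq ξ σ j, argSeq ξ σ l⁆ else argSeq ξ σ (l + i)) x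
      = ∑ σ : Equiv.Perm (Fin (k + l)), (Equiv.Perm.sign σ : ℤ) • ∑ i,
        evalT K (Function.update (fun i => ξ (σ (Fin.castAdd l i))) i
          ⁅evalT L fun j => ξ (σ (Fin.natAdd k j)), ξ (σ (Fin.castAdd l i))⁆) x := by
  rw [sum_sign_smul_sum_update (p := l) (fun v => evalT K v x) (evalT_comp_swap_apply K x)
    (Fin.castAdd l) (Fin.castAdd_injective k l) (Fin.natAdd k) (fun i j => by simp [Fin.ext_iff]; omega)
    (fun s m => ⁅evalT L fun i => ξ (s i), ξ m⁆) ξ, mul_comm, mul_smul]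
  congr 1
  -- The sign `(-1) ^ (k * l)` of the block swap cancels the same sign in the prefactor.
  rw [← Equiv.sum_comp (Equiv.mulRight (blockSwap k l)), Finset.smul_sum]
  refine Finset.sum_congr rfl fun σ _ => ?_
  have harg : (fun i : Fin k => if (i : ℕ) = 0
        then ⁅evalT L fun j => argSeq ξ (σ * blockSwap k l) j, argSeq ξ (σ * blockSwap k l) l⁆
        else argSeq ξ (σ * blockSwap k l) (l + i))
      = fun i : Fin k => if (i : ℕ) = 0
        then ⁅evalT L fun j => ξ (σ (Fin.natAdd k j)), ξ (σ (Fin.castAdd l i))⁆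
        else ξ (σ (Fin.castAdd l i)) := by
    funext i
    have := argSeq_mul_blockSwap_right ξ σ i
    split_ifs with hi
    · rw [hi, add_zero] at this
      simp only [argSeq_mul_blockSwap_left, this]
    · exact this
  simp only [Equiv.coe_mulRight, harg, map_mul, sign_blockSwap, ← Int.cast_smul_eq_zsmul ℝ,
    smul_smul]
  congr 1
  push_cast
  rw [mul_left_comm, ← mul_pow]
  simp

/-- The Frölicher-Nijenhuis bracket, with the terms in which a Lie bracket with a value of a form
is inserted summed over all argument slots. -/
theorem fnBracket_apply {k l : ℕ} (K : TForm E M k) (L : TForm E M l)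
    (ξ : Fin (k + l) → VectorFields E M) (x : M) :
    fnBracket K L ξ x
      = (1 / (k.factorial * l.factorial : ℝ)) •
          ∑ σ : Equiv.Perm (Fin (k + l)), (Equiv.Perm.sign σ : ℤ) •
            ((⁅evalT K fun i => ξ (σ (Fin.castAdd l i)),
                evalT L fun j => ξ (σ (Fin.natAdd k j))⁆ : VectorFields E M) x
            - ∑ j, evalT L (Function.update (fun j => ξ (σ (Fin.natAdd k j))) j
                ⁅evalT K fun i => ξ (σ (Fin.castAdd l i)), ξ (σ (Fin.natAdd k j))⁆) x
            + ∑ i, evalT K (Function.update (fun i => ξ (σ (Fin.castAdd l i))) i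
                ⁅evalT L fun j => ξ (σ (Fin.natAdd k j)), ξ (σ (Fin.castAdd l i))⁆) x)
        + ((-1) ^ (k + 1) * (k * l : ℝ) / (k.factorial * l.factorial * 2)) •
          ∑ σ : Equiv.Perm (Fin (k + l)), (Equiv.Perm.sign σ : ℤ) •
            evalT L (fun j => if (j : ℕ) = 0
              then evalT K fun i => if (i : ℕ) = 0
                then ⁅argSeq ξ σ 0, argSeq ξ σ 1⁆ else argSeq ξ σ (1 + i)
              else argSeq ξ σ (k + j)) x
        + ((-1) ^ ((k + 1) * l) * (k * l : ℝ) / (k.factorial * l.factorial * 2)) •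
          ∑ σ : Equiv.Perm (Fin (k + l)), (Equiv.Perm.sign σ : ℤ) •
            evalT K (fun i => if (i : ℕ) = 0
              then evalT L fun j => if (j : ℕ) = 0
                then ⁅argSeq ξ σ 0, argSeq ξ σ 1⁆ else argSeq ξ σ (1 + j)
              else argSeq ξ σ (l + i)) x := by
  rw [← VectorFields.valueAt_apply, fnBracket]
  simp only [map_add, map_sub, map_smul, map_sum, map_zsmul, VectorFields.valueAt_apply]
  congr 2
  simp only [smul_add, smul_sub, Finset.sum_add_distrib, Finset.sum_sub_distrib,
    ← sum_evalT_lie_left, ← sum_evalT_lie_right, smul_smul]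
  simp only [argSeq_coe_left, argSeq_coe_right]
  congr 2
  · rw [one_div_mul_eq_div]
  · rw [one_div_mul_eq_div]

end Bracket

/-! ### Values of vector valued forms -/

section Values

variable {E : Type*} [NormedAddCommGroup E] [NormedSpace ℝ E]
  {M : Type*} [TopologicalSpace M] [ChartedSpace E M] [IsManifold 𝓘(ℝ, E) ∞ M]
  {V : Type*} [NormedAddCommGroup V] [NormedSpace ℝ V]

theorem contMDiff_evalV {p : ℕ} (φ : VForm E M V p) (ξ : Fin p → VectorFields E M) :
    ContMDiff 𝓘(ℝ, E) 𝓘(ℝ, V) ∞ (evalV φ ξ) := φ.2 ξ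

theorem mdifferentiableAt_evalV {p : ℕ} (φ : VForm E M V p) (ξ : Fin p → VectorFields E M)
    (x : M) : MDifferentiableAt 𝓘(ℝ, E) 𝓘(ℝ, V) (evalV φ ξ) x :=
  (contMDiff_evalV φ ξ).mdifferentiableAt (by simp)

theorem evalV_update_apply {p : ℕ} (φ : VForm E M V p) (ξ : Fin p → VectorFields E M) (j : Fin p)
    (F : VectorFields E M) (x : M) :
    evalV φ (Function.update ξ j F) x = φ.1 x (Function.update (fun i => ξ i x) j (F x)) := by
  rw [evalV]
  congr 1
  funext i
  by_cases h : i = j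
  · subst h; simp
  · simp [h]

end Values

variable {E : Type*} [NormedAddCommGroup E] [NormedSpace ℝ E] [FiniteDimensional ℝ E]
  {M : Type*} [TopologicalSpace M] [ChartedSpace E M] [IsManifold 𝓘(ℝ, E) ∞ M]
  {𝔤 : Type*} [NormedLieRing 𝔤] [NormedLieAlgebra 𝔤]

/-! ### The bracket of Lie algebra valued forms preserves basic forms -/

section Wedge

/-- The Lie bracket of a finite dimensional Lie algebra, as a continuous bilinear map. -/
noncomputable def bracketCLM [FiniteDimensional ℝ 𝔤] : 𝔤 →L[ℝ] 𝔤 →L[ℝ] 𝔤 :=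
  (LieModule.toEnd ℝ 𝔤 𝔤 : 𝔤 →ₗ[ℝ] 𝔤 →ₗ[ℝ] 𝔤).toContinuousBilinearMap

variable [FiniteDimensional ℝ 𝔤]

omit [FiniteDimensional ℝ E] [IsManifold 𝓘(ℝ, E) ∞ M] in
theorem mvfderiv_lie_apply {f g : M → 𝔤} {x : M}
    (hf : MDifferentiableAt 𝓘(ℝ, E) 𝓘(ℝ, 𝔤) f x) (hg : MDifferentiableAt 𝓘(ℝ, E) 𝓘(ℝ, 𝔤) g x)
    (v : TangentSpace 𝓘(ℝ, E) x) :
    mvfderiv 𝓘(ℝ, E) (fun y => ⁅f y, g y⁆) x v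
      = ⁅mvfderiv 𝓘(ℝ, E) f x v, g x⁆ + ⁅f x, mvfderiv 𝓘(ℝ, E) g x v⁆ :=
  mvfderiv_bilin_apply bracketCLM hf hg v

omit [FiniteDimensional ℝ E] [IsManifold 𝓘(ℝ, E) ∞ M] in
theorem contMDiff_lie {f g : M → 𝔤} (hf : ContMDiff 𝓘(ℝ, E) 𝓘(ℝ, 𝔤) ∞ f)
    (hg : ContMDiff 𝓘(ℝ, E) 𝓘(ℝ, 𝔤) ∞ g) :
    ContMDiff 𝓘(ℝ, E) 𝓘(ℝ, 𝔤) ∞ fun x => ⁅f x, g x⁆ :=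
  (bracketCLM (𝔤 := 𝔤)).isBoundedBilinearMap.contDiff.contMDiff.comp (hf.prodMk_space hg)

omit [FiniteDimensional ℝ E] in
theorem wedgeBracket_val_apply {p q : ℕ} (φ : VForm E M 𝔤 p) (ψ : VForm E M 𝔤 q) (x : M)
    (v : Fin (p + q) → TangentSpace 𝓘(ℝ, E) x) :
    (wedgeBracket φ ψ).1 x v = (1 / (p.factorial * q.factorial : ℝ)) •
      ∑ σ : Equiv.Perm (Fin (p + q)), (Equiv.Perm.sign σ : ℤ) •
        ⁅φ.1 x fun i => v (σ (Fin.castAdd q i)), ψ.1 x fun j => v (σ (Fin.natAdd p j))⁆ := by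
  simp only [wedgeBracket, AlternatingMap.smul_apply, MultilinearMap.alternatization_apply,
    MultilinearMap.domDomCongr_apply, lieTensor_apply, Units.smul_def]

omit [FiniteDimensional ℝ E] in
theorem evalV_wedgeBracket {p q : ℕ} (φ : VForm E M 𝔤 p) (ψ : VForm E M 𝔤 q)
    (ξ : Fin (p + q) → VectorFields E M) :
    evalV (wedgeBracket φ ψ) ξ = fun x => (1 / (p.factorial * q.factorial : ℝ)) •
      ∑ σ : Equiv.Perm (Fin (p + q)), (Equiv.Perm.sign σ : ℤ) •
        ⁅evalV φ (fun i => ξ (σ (Fin.castAdd q i))) x,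
          evalV ψ (fun j => ξ (σ (Fin.natAdd p j))) x⁆ := by
  funext x
  exact wedgeBracket_val_apply φ ψ x _

/-- The Lie derivative is a derivation of the bracket of Lie algebra valued forms. -/
theorem lieDerivV_wedgeBracket {p q : ℕ} (X : VectorFields E M) (φ : VForm E M 𝔤 p)
    (ψ : VForm E M 𝔤 q) (ξ : Fin (p + q) → VectorFields E M) (x : M) :
    lieDerivV X (wedgeBracket φ ψ) ξ x = (1 / (p.factorial * q.factorial : ℝ)) •
      ∑ σ : Equiv.Perm (Fin (p + q)), (Equiv.Perm.sign σ : ℤ) •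
        (⁅lieDerivV X φ (fun i => ξ (σ (Fin.castAdd q i))) x,
            evalV ψ (fun j => ξ (σ (Fin.natAdd p j))) x⁆
          + ⁅evalV φ (fun i => ξ (σ (Fin.castAdd q i))) x,
            lieDerivV X ψ (fun j => ξ (σ (Fin.natAdd p j))) x⁆) := by
  have hs (σ : Equiv.Perm (Fin (p + q))) : ContMDiff 𝓘(ℝ, E) 𝓘(ℝ, 𝔤) ∞ fun x =>
      ⁅evalV φ (fun i => ξ (σ (Fin.castAdd q i))) x,
        evalV ψ (fun j => ξ (σ (Fin.natAdd p j))) x⁆ :=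
    contMDiff_lie (contMDiff_evalV φ _) (contMDiff_evalV ψ _)
  have hsmul (c : ℝ) {f : M → 𝔤} (hf : ContMDiff 𝓘(ℝ, E) 𝓘(ℝ, 𝔤) ∞ f) :
      ContMDiff 𝓘(ℝ, E) 𝓘(ℝ, 𝔤) ∞ fun x => c • f x :=
    (contDiff_const_smul c).contMDiff.comp hf
  have hd (c : ℝ) {f : M → 𝔤} (hf : ContMDiff 𝓘(ℝ, E) 𝓘(ℝ, 𝔤) ∞ f) :
      mvfderiv 𝓘(ℝ, E) (fun y => c • f y) x (X x) = c • mvfderiv 𝓘(ℝ, E) f x (X x) :=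
    mvfderiv_clm_apply (c • ContinuousLinearMap.id ℝ 𝔤) (hf.mdifferentiableAt (by simp)) _
  have hupd (σ : Equiv.Perm (Fin (p + q))) :
      ∑ i, ⁅evalV φ (fun k => Function.update ξ i ⁅X, ξ i⁆ (σ (Fin.castAdd q k))) x,
          evalV ψ (fun k => Function.update ξ i ⁅X, ξ i⁆ (σ (Fin.natAdd p k))) x⁆
        = ∑ i, ⁅evalV φ (Function.update (fun k => ξ (σ (Fin.castAdd q k))) i
              ⁅X, ξ (σ (Fin.castAdd q i))⁆) x, evalV ψ (fun k => ξ (σ (Fin.natAdd p k))) x⁆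
          + ∑ j, ⁅evalV φ (fun k => ξ (σ (Fin.castAdd q k))) x,
              evalV ψ (Function.update (fun k => ξ (σ (Fin.natAdd p k))) j
                ⁅X, ξ (σ (Fin.natAdd p j))⁆) x⁆ := by
    -- Numbered through `σ`, the slots split into the two blocks, and an update in one block leaves
    -- the other factor unchanged.
    rw [← Equiv.sum_comp σ, Fin.sum_univ_add]
    have hne (i : Fin p) (j : Fin q) : Fin.castAdd q i ≠ Fin.natAdd p j := by
      simp [Fin.ext_iff]; omega
    congr 1 <;> refine Finset.sum_congr rfl fun i _ => ?_ <;> congr 2 <;> funext k <;>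
      simp [Function.update_apply, hne, (hne _ _).symm]
  -- Signs become real scalars, so that `hd` can pull them out of the derivative.
  have hzs (n : ℤ) (y : 𝔤) : n • y = (n : ℝ) • y := (Int.cast_smul_eq_zsmul ℝ n y).symm
  rw [lieDerivV, evalV_wedgeBracket]
  simp only [evalV_wedgeBracket, hzs]
  rw [hd _ (contMDiff_finsetSum fun σ _ => hsmul _ (hs σ)), mvfderiv_sum_apply _
    fun σ _ => hsmul _ (hs σ)]
  simp only [hd _ (hs _)]
  rw [← Finset.smul_sum, ← smul_sub, Finset.sum_comm, ← Finset.sum_sub_distrib]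
  congr 1
  refine Finset.sum_congr rfl fun σ _ => ?_
  rw [← Finset.smul_sum, ← smul_sub, hupd σ, mvfderiv_lie_apply (mdifferentiableAt_evalV _ _ _)
    (mdifferentiableAt_evalV _ _ _)]
  congr 1
  simp only [lieDerivV, sub_lie, lie_sub, sum_lie, lie_sum]
  abel

variable {ζ : 𝔤 →ₗ⁅ℝ⁆ VectorFields E M}

theorem IsHorizontalV.wedgeBracket {p q : ℕ} {φ : VForm E M 𝔤 p} {ψ : VForm E M 𝔤 q}
    (hφ : IsHorizontalV ζ φ) (hψ : IsHorizontalV ζ ψ) :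
    IsHorizontalV ζ (wedgeBracket φ ψ) := by
  intro x v i X hi
  rw [wedgeBracket_val_apply]
  rw [Finset.sum_eq_zero, smul_zero]
  intro σ _
  obtain ⟨m, rfl⟩ := σ.surjective i
  induction m using Fin.addCases with
  | left m => rw [hφ x _ m X hi, zero_lie, smul_zero]
  | right m => rw [hψ x (fun j => v (σ (Fin.natAdd p j))) m X hi, lie_zero, smul_zero]

/-- Both the Lie derivative and, by the Jacobi identity, `ad X` are derivations of the bracket. -/
theorem IsEquivariant.wedgeBracket {p q : ℕ} {φ : VForm E M 𝔤 p} {ψ : VForm E M 𝔤 q}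
    (hφ : IsEquivariant ζ φ) (hψ : IsEquivariant ζ ψ) :
    IsEquivariant ζ (wedgeBracket φ ψ) := by
  intro X ξ x
  rw [lieDerivV_wedgeBracket, evalV_wedgeBracket]
  simp only [hφ X _ x, hψ X _ x]
  rw [lie_smul, ← smul_neg, lie_sum, ← Finset.sum_neg_distrib]
  congr 1
  refine Finset.sum_congr rfl fun σ _ => ?_
  rw [lie_zsmul, ← smul_neg]
  congr 1
  rw [leibniz_lie, neg_lie, lie_neg]
  abel

theorem IsBasic.wedgeBracket {p q : ℕ} {φ : VForm E M 𝔤 p} {ψ : VForm E M 𝔤 q}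
    (hφ : IsBasic ζ φ) (hψ : IsBasic ζ ψ) : IsBasic ζ (wedgeBracket φ ψ) :=
  ⟨hφ.horizontal.wedgeBracket hψ.horizontal, hφ.equivariant.wedgeBracket hψ.equivariant⟩

end Wedge

/-! ### Lie brackets and Lie derivatives of the forms `ζ_φ` -/

section Action

variable [FiniteDimensional ℝ 𝔤] (ζ : 𝔤 →ₗ⁅ℝ⁆ VectorFields E M)

omit [FiniteDimensional ℝ 𝔤] in
theorem actionAt_apply (x : M) (X : 𝔤) : actionAt ζ x X = ζ X x := rfl

theorem evalT_zeta_apply {p : ℕ} (φ : VForm E M 𝔤 p) (ξ : Fin p → VectorFields E M) (x : M) :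
    evalT (zeta ζ p φ) ξ x = actionAt ζ x (evalV φ ξ x) := rfl

theorem lie_evalT_zeta_apply {p : ℕ} (X : VectorFields E M) (φ : VForm E M 𝔤 p)
    (ξ : Fin p → VectorFields E M) (x : M) :
    (⁅X, evalT (zeta ζ p φ) ξ⁆ : VectorFields E M) x
      = actionAt ζ x (mvfderiv 𝓘(ℝ, E) (evalV φ ξ) x (X x))
        + (⁅X, ζ (evalV φ ξ x)⁆ : VectorFields E M) x :=
  lie_action_comp_apply ζ X _ _ (contMDiff_evalV φ ξ) (evalT_zeta_apply ζ φ ξ) x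

theorem evalT_zeta_lie_apply {p : ℕ} (X : VectorFields E M) (φ : VForm E M 𝔤 p)
    (ξ : Fin p → VectorFields E M) (x : M) :
    (⁅evalT (zeta ζ p φ) ξ, X⁆ : VectorFields E M) x
      = (⁅ζ (evalV φ ξ x), X⁆ : VectorFields E M) x
        - actionAt ζ x (mvfderiv 𝓘(ℝ, E) (evalV φ ξ) x (X x)) := by
  rw [lie_skew_apply, lie_evalT_zeta_apply, lie_skew_apply (ζ _)]
  abel

/-- The Leibniz rule in both entries freezes both values at `x`; the bracket of the frozen fields is
computed in `𝔤`, since `ζ` is a homomorphism. -/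
theorem lie_evalT_zeta_evalT_zeta_apply {p q : ℕ} (φ : VForm E M 𝔤 p) (ψ : VForm E M 𝔤 q)
    (ξ : Fin p → VectorFields E M) (η : Fin q → VectorFields E M) (x : M) :
    (⁅evalT (zeta ζ p φ) ξ, evalT (zeta ζ q ψ) η⁆ : VectorFields E M) x
      = actionAt ζ x (mvfderiv 𝓘(ℝ, E) (evalV ψ η) x (evalT (zeta ζ p φ) ξ x)
          - mvfderiv 𝓘(ℝ, E) (evalV φ ξ) x (evalT (zeta ζ q ψ) η x)
          + ⁅evalV φ ξ x, evalV ψ η x⁆) := by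
  rw [lie_evalT_zeta_apply, evalT_zeta_lie_apply, ← LieHom.map_lie, map_add, map_sub,
    actionAt_apply ζ x ⁅_, _⁆, sub_add_eq_add_sub, add_sub_assoc, evalT_zeta_apply ζ ψ]
  rfl

variable {ζ}

/-- For an equivariant form `ψ` and a function `f = φ(ξ)`, the sum of the values of `ψ` with
`[ζ_f, η_j]` in the slot `j`. -/
theorem IsEquivariant.sum_evalV_update_lie {p q : ℕ} {ψ : VForm E M 𝔤 q}
    (hψ : IsEquivariant ζ ψ) (φ : VForm E M 𝔤 p) (ξ : Fin p → VectorFields E M)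
    (η : Fin q → VectorFields E M) (x : M) :
    ∑ j, evalV ψ (Function.update η j ⁅evalT (zeta ζ p φ) ξ, η j⁆) x
      = mvfderiv 𝓘(ℝ, E) (evalV ψ η) x (evalT (zeta ζ p φ) ξ x)
        + ⁅evalV φ ξ x, evalV ψ η x⁆
        - ∑ j, ψ.1 x (Function.update (fun i => η i x) j
            (actionAt ζ x (mvfderiv 𝓘(ℝ, E) (evalV φ ξ) x (η j x)))) := by
  -- Equivariance concerns constant elements of `𝔤`, so it is used for the value of `φ` frozen at
  -- `x`; the variation of that value gives the last sum.
  have h := hψ (evalV φ ξ x) η x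
  rw [lieDerivV, sub_eq_iff_eq_add, neg_add_eq_sub] at h
  simp only [evalV_update_apply, evalT_zeta_lie_apply, AlternatingMap.map_update_sub,
    Finset.sum_sub_distrib] at h ⊢
  rw [evalT_zeta_apply, actionAt_apply, h]
  abel

/-- The Frölicher-Nijenhuis bracket of `ζ_φ` and `ζ_ψ` for equivariant forms `φ` and `ψ`. -/
theorem IsEquivariant.fnBracket_zeta_apply {p q : ℕ} {φ : VForm E M 𝔤 p} {ψ : VForm E M 𝔤 q}
    (hφ : IsEquivariant ζ φ) (hψ : IsEquivariant ζ ψ)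
    (ξ : Fin (p + q) → VectorFields E M) (x : M) :
    fnBracket (zeta ζ p φ) (zeta ζ q ψ) ξ x = actionAt ζ x
      (-evalV (GManifold.wedgeBracket φ ψ) ξ x + (1 / (p.factorial * q.factorial : ℝ)) •
          ∑ σ : Equiv.Perm (Fin (p + q)), (Equiv.Perm.sign σ : ℤ) •
            ((∑ j, ψ.1 x (Function.update (fun j => ξ (σ (Fin.natAdd p j)) x) j
                (actionAt ζ x (mvfderiv 𝓘(ℝ, E) (evalV φ fun i => ξ (σ (Fin.castAdd q i))) x
                  (ξ (σ (Fin.natAdd p j)) x)))))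
            - ∑ i, φ.1 x (Function.update (fun i => ξ (σ (Fin.castAdd q i)) x) i
                (actionAt ζ x (mvfderiv 𝓘(ℝ, E) (evalV ψ fun j => ξ (σ (Fin.natAdd p j))) x
                  (ξ (σ (Fin.castAdd q i)) x)))))
        + ((-1) ^ (p + 1) * (p * q : ℝ) / (p.factorial * q.factorial * 2)) •
          ∑ σ : Equiv.Perm (Fin (p + q)), (Equiv.Perm.sign σ : ℤ) •
            evalV ψ (fun j => if (j : ℕ) = 0
              then evalT (zeta ζ p φ) fun i => if (i : ℕ) = 0
                then ⁅argSeq ξ σ 0, argSeq ξ σ 1⁆ else argSeq ξ σ (1 + i)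
              else argSeq ξ σ (p + j)) x
        + ((-1) ^ ((p + 1) * q) * (p * q : ℝ) / (p.factorial * q.factorial * 2)) •
          ∑ σ : Equiv.Perm (Fin (p + q)), (Equiv.Perm.sign σ : ℤ) •
            evalV φ (fun i => if (i : ℕ) = 0
              then evalT (zeta ζ q ψ) fun j => if (j : ℕ) = 0
                then ⁅argSeq ξ σ 0, argSeq ξ σ 1⁆ else argSeq ξ σ (1 + j)
              else argSeq ξ σ (q + i)) x) := by
  rw [fnBracket_apply]
  simp only [evalT_zeta_apply, lie_evalT_zeta_evalT_zeta_apply, ← map_sum, ← map_sub, ← map_add,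
    ← map_zsmul, ← map_smul]
  congr 3
  rw [evalV_wedgeBracket]
  simp only []
  rw [← smul_neg, ← smul_add, ← Finset.sum_neg_distrib, ← Finset.sum_add_distrib]
  congr 1
  refine Finset.sum_congr rfl fun σ _ => ?_
  rw [← smul_neg, ← smul_add]
  congr 1
  -- The derivatives along `ζ_φ` and `ζ_ψ` cancel, and `[φ, ψ] - [φ, ψ] + [ψ, φ]` leaves `-[φ, ψ]`.
  rw [hψ.sum_evalV_update_lie, hφ.sum_evalV_update_lie, ← lie_skew (evalV φ _ x),
    evalT_zeta_apply, evalT_zeta_apply]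
  abel

theorem IsHorizontalV.isHorizontalT_zeta {q : ℕ} {ψ : VForm E M 𝔤 q} (hψ : IsHorizontalV ζ ψ) :
    IsHorizontalT ζ (zeta ζ q ψ) := by
  intro x v i X hi
  change actionAt ζ x (ψ.1 x v) = 0
  rw [hψ x v i X hi, map_zero]

omit [FiniteDimensional ℝ 𝔤] in
theorem IsHorizontalV.evalV_eq_zero {q : ℕ} {ψ : VForm E M 𝔤 q} (hψ : IsHorizontalV ζ ψ)
    (η : Fin q → VectorFields E M) (x : M) (i : Fin q) (X : 𝔤) (hi : η i x = actionAt ζ x X) :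
    evalV ψ η x = 0 :=
  hψ x _ i X hi

omit [FiniteDimensional ℝ 𝔤] in
theorem IsHorizontalV.apply_update {q : ℕ} {ψ : VForm E M 𝔤 q} (hψ : IsHorizontalV ζ ψ) (x : M)
    (v : Fin q → TangentSpace 𝓘(ℝ, E) x) (i : Fin q) (X : 𝔤) :
    ψ.1 x (Function.update v i (actionAt ζ x X)) = 0 :=
  hψ x _ i X (Function.update_self ..)

/-- By the Leibniz rule the left side is `ζ` applied to `L_{ζ_X} ψ + [X, ψ]`, which is zero by
equivariance. -/
theorem IsEquivariant.lieDerivT_zeta {q : ℕ} {ψ : VForm E M 𝔤 q} (hψ : IsEquivariant ζ ψ)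
    (X : 𝔤) (ξ : Fin q → VectorFields E M) : lieDerivT (ζ X) (zeta ζ q ψ) ξ = 0 := by
  ext x
  have h := hψ X ξ x
  rw [lieDerivV] at h
  rw [lieDerivT, ← VectorFields.valueAt_apply]
  simp only [map_sub, map_sum]
  simp only [VectorFields.valueAt_apply, evalT_zeta_apply]
  rw [lie_evalT_zeta_apply, ← LieHom.map_lie, ← actionAt_apply ζ x ⁅X, _⁆, add_sub_right_comm, ← map_sum,
    ← map_sub, ← map_add, h, neg_add_cancel, map_zero]
  rfl

/-- The Frölicher-Nijenhuis bracket with a vector field is the Lie derivative. -/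
theorem fnBracket_fieldForm_apply {q : ℕ} (X : VectorFields E M) (K : TForm E M q)
    (ξ : Fin (0 + q) → VectorFields E M) (x : M) :
    fnBracket (fieldForm X) K ξ x = (1 / q.factorial : ℝ) •
      ∑ σ : Equiv.Perm (Fin (0 + q)), (Equiv.Perm.sign σ : ℤ) •
        lieDerivT X K (fun j => ξ (σ (Fin.natAdd 0 j))) x := by
  have hX (η : Fin 0 → VectorFields E M) : evalT (fieldForm X) η = X := rfl
  rw [fnBracket_apply]
  -- In degree `0` there is no slot to insert into, and both nested terms carry the factor `k = 0`.
  simp only [hX, Finset.univ_eq_empty, Finset.sum_empty, Nat.cast_zero, zero_mul, mul_zero,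
    zero_div, zero_smul, add_zero, Nat.factorial_zero, Nat.cast_one, one_mul]
  congr 1
  refine Finset.sum_congr rfl fun σ _ => ?_
  rw [lieDerivT, ← VectorFields.valueAt_apply x (_ - _), map_sub, map_sum]
  rfl

end Action

/-! ### Basic forms and principal connection forms -/

section Connection

variable {E : Type*} [NormedAddCommGroup E] [NormedSpace ℝ E] [FiniteDimensional ℝ E]
  {M : Type*} [TopologicalSpace M] [ChartedSpace E M] [IsManifold 𝓘(ℝ, E) ∞ M]
  {𝔤 : Type*} [NormedLieRing 𝔤] [NormedLieAlgebra 𝔤] [FiniteDimensional ℝ 𝔤]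
  {ζ : 𝔤 →ₗ⁅ℝ⁆ VectorFields E M}

/-- The entry in slot `0` is a value of the action, which `ψ` kills. For `q = 0` there is no such
slot, but the coefficient is zero. -/
theorem IsHorizontalV.sum_nested_eq_zero {p q : ℕ} {ψ : VForm E M 𝔤 q}
    (hψ : IsHorizontalV ζ ψ) (φ : VForm E M 𝔤 p) {ι : Type*} [Fintype ι] (s : ι → ℤ)
    (η : ι → Fin p → VectorFields E M) (θ : ι → Fin q → VectorFields E M) (x : M) (a b c : ℝ) :
    (a * (b * q) / c) • ∑ σ, s σ • evalV ψ
      (fun j => if (j : ℕ) = 0 then evalT (zeta ζ p φ) (η σ) else θ σ j) x = 0 := by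
  obtain _ | q := q
  · simp
  · rw [Finset.sum_eq_zero, smul_zero]
    intro σ _
    rw [hψ.evalV_eq_zero _ x 0 (evalV φ (η σ) x) (by simp [evalT_zeta_apply]), smul_zero]

theorem IsBasic.fnBracket_zeta_apply {p q : ℕ} {φ : VForm E M 𝔤 p} {ψ : VForm E M 𝔤 q}
    (hφ : IsBasic ζ φ) (hψ : IsBasic ζ ψ) (ξ : Fin (p + q) → VectorFields E M) (x : M) :
    fnBracket (zeta ζ p φ) (zeta ζ q ψ) ξ x
      = -actionAt ζ x (evalV (GManifold.wedgeBracket φ ψ) ξ x) := by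
  rw [hφ.equivariant.fnBracket_zeta_apply hψ.equivariant, hψ.horizontal.sum_nested_eq_zero,
    -- `sum_nested_eq_zero` expects the degree of the form it kills as the last factor.
    mul_comm (p : ℝ), hφ.horizontal.sum_nested_eq_zero]
  simp only [hφ.horizontal.apply_update, hψ.horizontal.apply_update, Finset.sum_const_zero,
    sub_zero, smul_zero, add_zero, map_neg]

omit [FiniteDimensional ℝ 𝔤] in
theorem IsPrincipalConnectionForm.actionAt_apply_update {w : VForm E M 𝔤 1}
    (hw : IsPrincipalConnectionForm ζ w) (x : M) (v : Fin 1 → TangentSpace 𝓘(ℝ, E) x) (i : Fin 1)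
    (X : 𝔤) : actionAt ζ x (w.1 x (Function.update v i (actionAt ζ x X))) = actionAt ζ x X := by
  have : Function.update v i (actionAt ζ x X) = fun _ => ζ X x := by
    funext j
    rw [Subsingleton.elim j i, Function.update_self, actionAt_apply]
  rw [this]
  exact hw.action_comp x X

theorem IsPrincipalConnectionForm.actionAt_evalV_nested {w : VForm E M 𝔤 1}
    (hw : IsPrincipalConnectionForm ζ w) {q : ℕ} (ψ : VForm E M 𝔤 q)
    (η : Fin q → VectorFields E M) (θ : Fin 1 → VectorFields E M) (x : M) :
    actionAt ζ x (evalV w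
        (fun i => if (i : ℕ) = 0 then evalT (zeta ζ q ψ) η else θ i) x)
      = actionAt ζ x (evalV ψ η x) := by
  have : (fun i : Fin 1 => if (i : ℕ) = 0 then evalT (zeta ζ q ψ) η else θ i)
      = fun _ => evalT (zeta ζ q ψ) η := by
    funext i
    simp
  rw [this]
  exact hw.action_comp x (evalV ψ η x)

theorem extDerivV_apply {V : Type*} [NormedAddCommGroup V] [NormedSpace ℝ V] {q : ℕ}
    (ψ : VForm E M V q) (ξ : Fin (1 + q) → VectorFields E M) (x : M) :
    extDerivV ψ ξ x = (1 / (q.factorial : ℝ)) •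
        ∑ σ : Equiv.Perm (Fin (1 + q)), (Equiv.Perm.sign σ : ℤ) •
          mvfderiv 𝓘(ℝ, E) (evalV ψ fun j => ξ (σ (Fin.natAdd 1 j))) x (ξ (σ (Fin.castAdd q 0)) x)
      - ((q : ℝ) / (q.factorial * 2)) •
        ∑ σ : Equiv.Perm (Fin (1 + q)), (Equiv.Perm.sign σ : ℤ) •
          evalV ψ (fun j => if (j : ℕ) = 0 then ⁅argSeq ξ σ 0, argSeq ξ σ 1⁆
            else argSeq ξ σ (1 + j)) x := by
  have h0 (σ : Equiv.Perm (Fin (1 + q))) : argSeq ξ σ 0 = ξ (σ (Fin.castAdd q 0)) :=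
    argSeq_coe_left ξ σ (0 : Fin 1)
  rw [extDerivV]
  congr 2
  exact Finset.sum_congr rfl fun σ _ => by simp only [argSeq_coe_right, h0]

/-- Corrections with a `ζ`-value inside `ψ` vanish. Those inside `w` lose the `w` by `ζ ∘ w ∘ ζ =
ζ`: the derivative correction becomes the first sum of `dψ`, the nested term the second. -/
theorem IsPrincipalConnectionForm.fnBracket_zeta_apply {w : VForm E M 𝔤 1}
    (hw : IsPrincipalConnectionForm ζ w) {q : ℕ} {ψ : VForm E M 𝔤 q} (hψ : IsBasic ζ ψ)
    (ξ : Fin (1 + q) → VectorFields E M) (x : M) :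
    fnBracket (zeta ζ 1 w) (zeta ζ q ψ) ξ x
      = -actionAt ζ x (extDerivV ψ ξ x + evalV (wedgeBracket w ψ) ξ x) := by
  rw [hw.equivariant.fnBracket_zeta_apply hψ.equivariant, hψ.horizontal.sum_nested_eq_zero,
    extDerivV_apply]
  simp only [hψ.horizontal.apply_update, Finset.sum_const_zero, zero_sub, add_zero, map_add,
    map_neg, map_sub, map_smul, map_sum, map_zsmul, hw.actionAt_apply_update,
    hw.actionAt_evalV_nested, Finset.univ_unique, Finset.sum_singleton, smul_neg,
    Finset.sum_neg_distrib, Fin.default_eq_zero, Nat.factorial_one, Nat.cast_one, one_mul, pow_mul,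
    Nat.reduceAdd, even_two, Even.neg_pow, one_pow]
  abel

theorem IsPrincipalConnectionForm.fnBracket_zeta_self_apply {w : VForm E M 𝔤 1}
    (hw : IsPrincipalConnectionForm ζ w) (ξ : Fin (1 + 1) → VectorFields E M) (x : M) :
    (1 / 2 : ℝ) • fnBracket (zeta ζ 1 w) (zeta ζ 1 w) ξ x
      = -actionAt ζ x (extDerivV w ξ x + (1 / 2 : ℝ) • evalV (wedgeBracket w w) ξ x) := by
  -- Without horizontality both derivative corrections remain. Swapping the two arguments, an odd
  -- permutation, shows that they contribute equally.
  have hswap : ∑ σ : Equiv.Perm (Fin (1 + 1)), (Equiv.Perm.sign σ : ℤ) •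
        actionAt ζ x (mvfderiv 𝓘(ℝ, E) (evalV w fun i => ξ (σ (Fin.castAdd 1 i))) x
          (ξ (σ (Fin.natAdd 1 0)) x))
      = -∑ σ : Equiv.Perm (Fin (1 + 1)), (Equiv.Perm.sign σ : ℤ) •
        actionAt ζ x (mvfderiv 𝓘(ℝ, E) (evalV w fun i => ξ (σ (Fin.natAdd 1 i))) x
          (ξ (σ (Fin.castAdd 1 0)) x)) := by
    rw [← Equiv.sum_comp (Equiv.mulRight (blockSwap 1 1)), ← Finset.sum_neg_distrib]
    refine Finset.sum_congr rfl fun σ _ => ?_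
    have h0 (i : Fin 1) : blockSwap 1 1 (Fin.castAdd 1 i) = Fin.natAdd 1 i := blockSwap_of_lt i.2 _
    have h1 (i : Fin 1) : blockSwap 1 1 (Fin.natAdd 1 i) = Fin.castAdd 1 i := blockSwap_add i.2 _
    simp only [Equiv.coe_mulRight, Equiv.Perm.mul_apply, h0, h1, map_mul, sign_blockSwap]
    simp
  rw [hw.equivariant.fnBracket_zeta_apply hw.equivariant, extDerivV_apply]
  simp only [map_add, map_neg, map_sub, map_smul, map_sum, map_zsmul, hw.actionAt_apply_update,
    hw.actionAt_evalV_nested, Finset.univ_unique, Finset.sum_singleton, smul_sub,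
    Finset.sum_sub_distrib, Fin.default_eq_zero, Nat.factorial_one, Nat.cast_one, hswap]
  module

end Connection

end GManifold

theorem proposition4p4
    {E : Type*} [NormedAddCommGroup E] [NormedSpace ℝ E] [FiniteDimensional ℝ E]
    {M : Type*} [TopologicalSpace M] [T2Space M] [ChartedSpace E M] [IsManifold 𝓘(ℝ, E) ∞ M]
    {𝔤 : Type*} [NormedLieRing 𝔤] [NormedLieAlgebra 𝔤] [FiniteDimensional ℝ 𝔤]
    (ζ : 𝔤 →ₗ⁅ℝ⁆ VectorFields E M) :
    (∀ (q : ℕ) (ψ : VForm E M 𝔤 q), IsBasic ζ ψ →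
      IsHorizontalT ζ (zeta ζ q ψ) ∧
      (∀ (X : 𝔤) (ξ : Fin q → VectorFields E M), lieDerivT (ζ X) (zeta ζ q ψ) ξ = 0) ∧
      (∀ (X : 𝔤) (ξ : Fin (0 + q) → VectorFields E M),
        fnBracket (fieldForm (ζ X)) (zeta ζ q ψ) ξ = 0)) ∧
    (∀ (p q : ℕ) (φ : VForm E M 𝔤 p) (ψ : VForm E M 𝔤 q), IsBasic ζ φ → IsBasic ζ ψ →
      IsBasic ζ (wedgeBracket φ ψ) ∧
      ∀ ξ : Fin (p + q) → VectorFields E M,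
        fnBracket (zeta ζ p φ) (zeta ζ q ψ) ξ
          = -evalT (zeta ζ (p + q) (wedgeBracket φ ψ)) ξ) ∧
    (∀ w : VForm E M 𝔤 1, IsPrincipalConnectionForm ζ w →
      (∀ (q : ℕ) (ψ : VForm E M 𝔤 q), IsBasic ζ ψ →
        ∀ (ξ : Fin (1 + q) → VectorFields E M) (x : M),
          fnBracket (zeta ζ 1 w) (zeta ζ q ψ) ξ x
            = -ζ (extDerivV ψ ξ x + evalV (wedgeBracket w ψ) ξ x) x) ∧
      (∀ (ξ : Fin (1 + 1) → VectorFields E M) (x : M),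
        (1 / 2 : ℝ) • fnBracket (zeta ζ 1 w) (zeta ζ 1 w) ξ x
          = -ζ (extDerivV w ξ x + (1 / 2 : ℝ) • evalV (wedgeBracket w w) ξ x) x)) := by
  refine ⟨fun q ψ hψ =>
      ⟨hψ.horizontal.isHorizontalT_zeta, hψ.equivariant.lieDerivT_zeta, fun X ξ => ?_⟩,
    fun p q φ ψ hφ hψ => ⟨hφ.wedgeBracket hψ, fun ξ => ?_⟩,
    fun w hw => ⟨fun q ψ hψ => hw.fnBracket_zeta_apply hψ, hw.fnBracket_zeta_self_apply⟩⟩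
  · ext x
    rw [fnBracket_fieldForm_apply]
    simp only [hψ.equivariant.lieDerivT_zeta, ContMDiffSection.coe_zero, Pi.zero_apply, smul_zero,
      Finset.sum_const_zero]
  · ext x
    exact hφ.fnBracket_zeta_apply hψ ξ x
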